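/- Let $K$ denote prefix-free Kolmogorov complexity of finite binary strings over the alphabet $\{-1,1\}$ (with respect to a fixed universal prefix-free machine), and let $KC$ be the set of Kolmogorov–Chaitin complex strings, i.e. of all $\alpha=\alpha_0\alpha_1\alpha_2\cdots\in\{-1,1\}^{\mathbb N}$ for which there is a $k$ with $K(\alpha_0\cdots\alpha_{n-1})\ge n-k$ for all $n$. For $\alpha\in KC$ write $\varepsilon_n(\alpha)=\alpha_n$. A sequence $(u_n)_{n\ge 0}$ of real numbers is called computable if there is an algorithm that, given $n$ and $m$, outputs a dyadic rational within $2^{-m}$ of $u_n$; a real number $s$ is called computable if there is an algorithm that, given $m$, outputs a dyadic rational within $2^{-m}$ of $s$. Let $(u_n)$ be a computable sequence of real numbers. 1. If $\sum_n \varepsilon_n(\alpha) u_n$ converges in $\mathbb R$ for some $\alpha\in KC$, then $\sum_n u_n^2$ converges. 2. If $\sum_n \varepsilon_n(\alpha) u_n$ diverges (i.e. does not converge in $\mathbb R$) for some $\alpha\in KC$, then $\sum_n u_n^2$ either diverges or converges to a real number that is not computable. -/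

import Mathlib

open Filter Topology

/-! ### Prefix-free machines and Kolmogorov complexity -/

/-- A prefix-free (self-delimiting) machine: a partial computable function from finite binary
strings to finite binary strings whose domain contains no two distinct strings one of which is
an initial segment of the other. -/
structure IsPrefixFreeMachine (M : List Bool →. List Bool) : Prop where
  partrec : Partrec M
  prefixFree : ∀ τ ρ : List Bool, (M τ).Dom → (M ρ).Dom → τ <+: ρ → τ = ρ

/-- The complexity of the string `σ` relative to the machine `M`: the least length of a program
`τ` with `M τ = σ` (and `⊤` if there is no such program). -/
noncomputable def machineComplexity (M : List Bool →. List Bool) (σ : List Bool) : ℕ∞ :=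
  ⨅ (τ : List Bool) (_ : σ ∈ M τ), (τ.length : ℕ∞)

/-- A universal (additively optimal) prefix-free machine. -/
structure IsUniversalMachine (U : List Bool →. List Bool) : Prop where
  isPrefixFreeMachine : IsPrefixFreeMachine U
  optimal : ∀ M : List Bool →. List Bool, IsPrefixFreeMachine M →
    ∃ c : ℕ, ∀ σ : List Bool, machineComplexity U σ ≤ machineComplexity M σ + c

/-! The following auxiliary definitions and facts only serve to prove that a universal
prefix-free machine exists. -/

namespace UniversalMachine

open Nat.Partrec (Code)
open Encodable

/-- The `k`-th step of the search, for the machine coded by `c`, for a halting computation on a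
program comparable with `τ`. -/
def step (c : Code) (τ : List Bool) (k : ℕ) : Option (List Bool × List Bool) :=
  (decode k : Option (List Bool × ℕ)).bind fun p =>
    if p.1.take τ.length = τ.take p.1.length then
      (Code.evaln p.2 c (encode p.1)).bind fun y =>
        (decode y : Option (List Bool)).map fun σ => (p.1, σ)
    else none

/-- The machine coded by `c`, trimmed so as to become prefix-free. -/
def trim (c : Code) (τ : List Bool) : Part (List Bool) :=
  (Nat.rfindOpt (step c τ)).bind fun q =>
    ((if q.1 = τ then some q.2 else none : Option (List Bool)) : Part (List Bool))

/-- Splits `1 ⋯ 1 0 τ` into the number of leading ones and `τ`. -/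
def parse (p : List Bool) : Option (ℕ × List Bool) :=
  List.recOn p none fun b l ih => bif b then ih.map (fun x => (x.1 + 1, x.2)) else some (0, l)

/-- The universal machine: on `1 ⋯ 1 0 τ` with `e` leading ones, run the trimmed machine with
code number `e` on `τ`. -/
def univ (p : List Bool) : Part (List Bool) :=
  (parse p : Part (ℕ × List Bool)).bind fun x => trim (Denumerable.ofNat Code x.1) x.2

theorem mem_rfindOpt {α : Type*} {f : ℕ → Option α} {a : α} :
    a ∈ Nat.rfindOpt f ↔ ∃ k, f k = some a ∧ ∀ j < k, f j = none := by
  unfold Nat.rfindOpt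
  rw [Part.mem_bind_iff]
  constructor
  · rintro ⟨k, h1, h3⟩
    obtain ⟨_, h2⟩ := Nat.mem_rfind.1 h1
    refine ⟨k, by simpa using h3, fun j hj => ?_⟩
    have := h2 hj
    simpa using this
  · rintro ⟨k, h1, h2⟩
    exact ⟨k, Nat.mem_rfind.2 ⟨by simp [h1], fun {j} hj => by simp [h2 j hj]⟩, by simp [h1]⟩

theorem step_eq_some {c : Code} {τ : List Bool} {k : ℕ} {ρ σ : List Bool} :
    step c τ k = some (ρ, σ) ↔ ∃ s y, (decode k : Option (List Bool × ℕ)) = some (ρ, s) ∧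
      ρ.take τ.length = τ.take ρ.length ∧ y ∈ Code.evaln s c (encode ρ) ∧
      (decode y : Option (List Bool)) = some σ := by
  unfold step
  constructor
  · intro h
    obtain ⟨⟨ρ', s⟩, h1, h2⟩ := Option.bind_eq_some_iff.1 h
    split_ifs at h2 with h3
    · obtain ⟨y, h4, h5⟩ := Option.bind_eq_some_iff.1 h2
      obtain ⟨σ', h6, h7⟩ := Option.map_eq_some_iff.1 h5
      simp only [Prod.mk.injEq] at h7
      obtain ⟨rfl, rfl⟩ := h7
      exact ⟨s, y, h1, h3, h4, h6⟩
  · rintro ⟨s, y, h1, h2, h3, h4⟩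
    rw [h1]
    simp only [Option.bind_some, h2, if_true]
    rw [Option.mem_def.1 h3]
    simp [h4]

theorem mem_trim {c : Code} {τ σ : List Bool} :
    σ ∈ trim c τ ↔ ∃ k, step c τ k = some (τ, σ) ∧ ∀ j < k, step c τ j = none := by
  unfold trim
  simp only [Part.mem_bind_iff, mem_rfindOpt]
  constructor
  · rintro ⟨⟨ρ, σ'⟩, ⟨k, h1, h2⟩, h3⟩
    by_cases h : ρ = τ
    · subst h
      simp at h3
      subst h3
      exact ⟨k, h1, h2⟩
    · simp [h] at h3
  · rintro ⟨k, h1, h2⟩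
    exact ⟨(τ, σ), ⟨k, h1, h2⟩, by simp⟩

theorem take_comm_of_prefix {τ ρ : List Bool} (h : τ <+: ρ) :
    τ.take ρ.length = ρ.take τ.length := by
  rw [List.take_of_length_le h.length_le, List.prefix_iff_eq_take.1 h]
  simp

theorem prefix_or_of_take_eq {τ ρ : List Bool} (h : τ.take ρ.length = ρ.take τ.length) :
    τ <+: ρ ∨ ρ <+: τ := by
  rcases le_total τ.length ρ.length with hl | hl
  · left
    rw [List.take_of_length_le hl] at h
    exact List.prefix_iff_eq_take.2 h
  · right
    rw [List.take_of_length_le hl] at h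
    exact List.prefix_iff_eq_take.2 h.symm

theorem trim_prefixFree (c : Code) (τ ρ : List Bool) (hτ : (trim c τ).Dom)
    (hρ : (trim c ρ).Dom) (h : τ <+: ρ) : τ = ρ := by
  obtain ⟨σ₁, h₁⟩ := Part.dom_iff_mem.1 hτ
  obtain ⟨σ₂, h₂⟩ := Part.dom_iff_mem.1 hρ
  obtain ⟨k₁, a₁, b₁⟩ := mem_trim.1 h₁
  obtain ⟨k₂, a₂, b₂⟩ := mem_trim.1 h₂
  obtain ⟨s₁, y₁, d₁, -, e₁, f₁⟩ := step_eq_some.1 a₁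
  obtain ⟨s₂, y₂, d₂, -, e₂, f₂⟩ := step_eq_some.1 a₂
  have hc := take_comm_of_prefix h
  have g₁ : step c ρ k₁ = some (τ, σ₁) := step_eq_some.2 ⟨s₁, y₁, d₁, hc, e₁, f₁⟩
  have g₂ : step c τ k₂ = some (ρ, σ₂) := step_eq_some.2 ⟨s₂, y₂, d₂, hc.symm, e₂, f₂⟩
  rcases lt_trichotomy k₁ k₂ with hk | hk | hk
  · rw [b₂ k₁ hk] at g₁
    cases g₁
  · subst hk
    rw [d₁] at d₂
    cases d₂
    rfl
  · rw [b₁ k₂ hk] at g₂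
    cases g₂

theorem trim_of_prefixFree {M : List Bool →. List Bool} (hM : IsPrefixFreeMachine M) {c : Code}
    (hc : Code.eval c = fun n => Part.bind (decode (α := List Bool) n) fun a => (M a).map encode)
    {τ σ : List Bool} (h : σ ∈ M τ) : σ ∈ trim c τ := by
  have key : ∀ ρ y, y ∈ Code.eval c (encode ρ) ↔ ∃ σ' ∈ M ρ, encode σ' = y := by
    intro ρ y
    rw [hc]
    simp
  obtain ⟨s, hs⟩ := Code.evaln_complete.1 ((key τ (encode σ)).2 ⟨σ, h, rfl⟩)
  have hex : ∃ k, (step c τ k).isSome := by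
    refine ⟨encode (τ, s), ?_⟩
    rw [(step_eq_some (ρ := τ) (σ := σ)).2 ⟨s, encode σ, by simp, rfl, hs, by simp⟩]
    rfl
  obtain ⟨⟨ρ, σ'⟩, hq⟩ := Option.isSome_iff_exists.1 (Nat.find_spec hex)
  obtain ⟨s', y, -, hcomp, hy, hdec⟩ := step_eq_some.1 hq
  obtain ⟨σ'', hσ'', rfl⟩ := (key ρ y).1 (Code.evaln_sound hy)
  have hρτ : ρ = τ := by
    rcases prefix_or_of_take_eq hcomp with hp | hp
    · exact hM.prefixFree _ _ (Part.dom_iff_mem.2 ⟨_, hσ''⟩) (Part.dom_iff_mem.2 ⟨_, h⟩) hp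
    · exact (hM.prefixFree _ _ (Part.dom_iff_mem.2 ⟨_, h⟩) (Part.dom_iff_mem.2 ⟨_, hσ''⟩) hp).symm
  subst hρτ
  have hσ : σ' = σ := by
    simp only [encodek, Option.some.injEq] at hdec
    rw [← hdec]
    exact Part.mem_unique hσ'' h
  subst hσ
  refine mem_trim.2 ⟨Nat.find hex, hq, fun j hj => ?_⟩
  simpa using Nat.find_min hex hj

theorem parse_eq_some {p : List Bool} {e : ℕ} {τ : List Bool} :
    parse p = some (e, τ) ↔ p = List.replicate e true ++ false :: τ := by
  induction p generalizing e with
  | nil => simp [parse]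
  | cons b l ih =>
    cases b
    · have : parse (false :: l) = some (0, l) := rfl
      rw [this]
      cases e <;> simp [List.replicate_succ, eq_comm]
    · have : parse (true :: l) = (parse l).map (fun x => (x.1 + 1, x.2)) := rfl
      rw [this]
      cases e with
      | zero => simp
      | succ e =>
        rw [List.replicate_succ, List.cons_append, List.cons.injEq, ← ih]
        simp

theorem primrec_parse : Primrec parse := by
  refine (Primrec.list_rec (f := fun p : List Bool => p)
    (g := fun _ => (none : Option (ℕ × List Bool)))
    (h := fun _ q => bif q.1 then q.2.2.map (fun x => (x.1 + 1, x.2)) else some (0, q.2.1))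
    Primrec.id (Primrec.const _) ?_)
  refine Primrec.cond (Primrec.fst.comp Primrec.snd) ?_ ?_
  · refine Primrec.option_map (Primrec.snd.comp (Primrec.snd.comp Primrec.snd)) ?_
    exact (Primrec.pair (Primrec.succ.comp (Primrec.fst.comp Primrec.snd))
      (Primrec.snd.comp Primrec.snd)).to₂
  · exact Primrec.option_some.comp (Primrec.pair (Primrec.const 0)
      (Primrec.fst.comp (Primrec.snd.comp Primrec.snd)))

theorem primrec_run : Primrec₂ fun (c : Code) (p : List Bool × ℕ) =>
    (Code.evaln p.2 c (encode p.1)).bind fun y =>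
      (decode y : Option (List Bool)).map fun σ => (p.1, σ) := by
  refine Primrec.option_bind ?_ ?_
  · have h : Primrec fun x : Code × (List Bool × ℕ) => ((x.2.2, x.1), encode x.2.1) :=
      Primrec.pair (Primrec.pair (Primrec.snd.comp Primrec.snd) Primrec.fst)
        (Primrec.encode.comp (Primrec.fst.comp Primrec.snd))
    exact Code.primrec_evaln.comp h
  · refine Primrec.option_map (Primrec.decode.comp Primrec.snd) ?_
    exact Primrec.pair (Primrec.fst.comp (Primrec.snd.comp (Primrec.fst.comp Primrec.fst)))
      Primrec.snd

theorem primrec_comparable : PrimrecRel fun (τ : List Bool) (ρ : List Bool) =>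
    ρ.take τ.length = τ.take ρ.length :=
  PrimrecRel.comp Primrec.eq
    (Primrec.list_take.comp (Primrec.list_length.comp Primrec.fst) Primrec.snd)
    (Primrec.list_take.comp (Primrec.list_length.comp Primrec.snd) Primrec.fst)

theorem primrec_step : Primrec₂ fun (a : Code × List Bool) (k : ℕ) => step a.1 a.2 k := by
  unfold step
  refine Primrec.option_bind (Primrec.decode.comp Primrec.snd) ?_
  refine Primrec.ite ?_ ?_ (Primrec.const none)
  · exact PrimrecRel.comp (R := fun (τ : List Bool) (ρ : List Bool) =>
        ρ.take τ.length = τ.take ρ.length) primrec_comparable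
      (Primrec.snd.comp (Primrec.fst.comp Primrec.fst)) (Primrec.fst.comp Primrec.snd)
  · exact primrec_run.comp (Primrec.fst.comp (Primrec.fst.comp Primrec.fst)) Primrec.snd

theorem partrec_trim : Partrec fun a : Code × List Bool => trim a.1 a.2 := by
  unfold trim
  refine Partrec.bind (Partrec.rfindOpt primrec_step.to_comp) ?_
  refine Computable.ofOption (Primrec.to_comp ?_)
  refine Primrec.ite ?_ ?_ (Primrec.const none)
  · exact PrimrecRel.comp Primrec.eq (Primrec.fst.comp Primrec.snd)
      (Primrec.snd.comp Primrec.fst)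
  · exact Primrec.option_some.comp (Primrec.snd.comp Primrec.snd)

theorem primrec_code : Primrec fun x : List Bool × (ℕ × List Bool) =>
    Denumerable.ofNat Code x.2.1 :=
  (Primrec.ofNat Code).comp (Primrec.fst.comp Primrec.snd)

theorem computable_split : Computable fun x : List Bool × (ℕ × List Bool) =>
    (Denumerable.ofNat Code x.2.1, x.2.2) :=
  (primrec_code.pair (Primrec.snd.comp Primrec.snd)).to_comp

theorem partrec_run : Partrec fun x : List Bool × (ℕ × List Bool) =>
    trim (Denumerable.ofNat Code x.2.1) x.2.2 :=
  Partrec.comp (f := fun a : Code × List Bool => trim a.1 a.2)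
    (g := fun x : List Bool × (ℕ × List Bool) => (Denumerable.ofNat Code x.2.1, x.2.2))
    partrec_trim computable_split

theorem partrec_univ : Partrec univ :=
  Partrec.bind (Computable.ofOption primrec_parse.to_comp) partrec_run.to₂

theorem mem_univ {p σ : List Bool} : σ ∈ univ p ↔ ∃ e τ,
    p = List.replicate e true ++ false :: τ ∧ σ ∈ trim (Denumerable.ofNat Code e) τ := by
  simp only [univ, Part.mem_bind_iff, Part.mem_coe, Option.mem_def, Prod.exists, parse_eq_some]

theorem isUniversalMachine_univ : IsUniversalMachine univ := by
  refine ⟨⟨partrec_univ, fun p q hp hq h => ?_⟩, fun M hM => ?_⟩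
  · obtain ⟨σ₁, h₁⟩ := Part.dom_iff_mem.1 hp
    obtain ⟨σ₂, h₂⟩ := Part.dom_iff_mem.1 hq
    obtain ⟨e₁, τ₁, rfl, m₁⟩ := mem_univ.1 h₁
    obtain ⟨e₂, τ₂, rfl, m₂⟩ := mem_univ.1 h₂
    obtain ⟨t, ht⟩ := h
    have := (parse_eq_some (p := List.replicate e₂ true ++ false :: τ₂) (e := e₁)
      (τ := τ₁ ++ t)).2 (by rw [← ht]; simp)
    rw [parse_eq_some.2 rfl] at this
    simp only [Option.some.injEq, Prod.mk.injEq] at this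
    obtain ⟨rfl, rfl⟩ := this
    have := trim_prefixFree _ _ _ (Part.dom_iff_mem.2 ⟨_, m₁⟩) (Part.dom_iff_mem.2 ⟨_, m₂⟩)
      (List.prefix_append _ _)
    rw [← this]
  · obtain ⟨c, hc⟩ := Code.exists_code.1 hM.partrec
    refine ⟨encode c + 1, fun σ => ?_⟩
    by_cases hσ : ∃ τ, σ ∈ M τ
    · unfold machineComplexity
      have : Nonempty {τ // σ ∈ M τ} := let ⟨τ, h⟩ := hσ; ⟨⟨τ, h⟩⟩
      rw [iInf_subtype' (p := fun τ => σ ∈ M τ) (f := fun τ _ => ((τ.length : ℕ) : ℕ∞))]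
      obtain ⟨⟨τ, hτ⟩, hm⟩ := ciInf_mem fun x : {τ // σ ∈ M τ} => ((x.1.length : ℕ) : ℕ∞)
      rw [← hm]
      have hmem : σ ∈ univ (List.replicate (encode c) true ++ false :: τ) := by
        refine mem_univ.2 ⟨encode c, τ, rfl, ?_⟩
        rw [Denumerable.ofNat_encode]
        exact trim_of_prefixFree hM hc hτ
      refine (iInf₂_le (f := fun (p : List Bool) (_ : σ ∈ univ p) => ((p.length : ℕ) : ℕ∞))
        _ hmem).trans ?_
      simp only [List.length_append, List.length_replicate, List.length_cons]
      push_cast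
      exact le_of_eq (by ring)
    · have : machineComplexity M σ = ⊤ := by
        unfold machineComplexity
        simp only [iInf_eq_top]
        exact fun τ h => absurd ⟨τ, h⟩ hσ
      rw [this]
      simp

end UniversalMachine

theorem exists_isUniversalMachine : ∃ U : List Bool →. List Bool, IsUniversalMachine U :=
  ⟨_, UniversalMachine.isUniversalMachine_univ⟩

/-- The fixed universal prefix-free machine of reference. -/
noncomputable def referenceMachine : List Bool →. List Bool :=
  Classical.choose exists_isUniversalMachine

theorem isUniversalMachine_referenceMachine : IsUniversalMachine referenceMachine :=
  Classical.choose_spec exists_isUniversalMachine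

/-- The (prefix-free) Kolmogorov complexity `K(σ)` of a finite binary string. -/
noncomputable def kolmogorovComplexity (σ : List Bool) : ℕ∞ :=
  machineComplexity referenceMachine σ

/-- The initial segment `α₀ ⋯ αₙ₋₁` of length `n` of an infinite binary string. The space
`{-1, 1}^ω` is represented as `ℕ → Bool`, with `true` for `1` and `false` for `-1`. -/
def initialSegment (α : ℕ → Bool) (n : ℕ) : List Bool :=
  List.ofFn fun i : Fin n => α i

/-- The set of Kolmogorov-Chaitin complex strings:
there is `k` with `K(α₀ ⋯ αₙ₋₁) ≥ n - k` for all `n`. -/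
def KC : Set (ℕ → Bool) :=
  {α | ∃ k : ℕ, ∀ n : ℕ, (n : ℕ∞) ≤ kolmogorovComplexity (initialSegment α n) + k}

/-! ### Rademacher sequences and series -/

/-- The `n`-th bit of `α`, as the real number `1` or `-1`. -/
def rademacher (α : ℕ → Bool) (n : ℕ) : ℝ := if α n then 1 else -1

/-- The partial sums of the series `∑ aₙ` converge to the real number `s`. -/
def SeriesConvergesTo (a : ℕ → ℝ) (s : ℝ) : Prop :=
  Tendsto (fun N => ∑ n ∈ Finset.range N, a n) atTop (𝓝 s)

/-- The series `∑ aₙ` converges in `ℝ` (possibly only conditionally). -/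
def SeriesConverges (a : ℕ → ℝ) : Prop := ∃ s : ℝ, SeriesConvergesTo a s

/-! ### Computable real numbers -/

/-- A computable real number: a dyadic rational approximation of `x` with error at most `2⁻ᵐ`
can be computed from `m`. -/
def IsComputableReal (x : ℝ) : Prop :=
  ∃ z : ℕ → ℤ, Computable z ∧ ∀ m : ℕ, |x - (z m : ℝ) / 2 ^ m| ≤ 1 / 2 ^ m

/-- A computable sequence of real numbers: a dyadic rational approximation of `u n` with error
at most `2⁻ᵐ` can be computed from `n` and `m`. -/
def IsComputableRealSeq (u : ℕ → ℝ) : Prop :=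
  ∃ z : ℕ → ℕ → ℤ, Computable₂ z ∧ ∀ n m : ℕ, |u n - (z n m : ℝ) / 2 ^ m| ≤ 1 / 2 ^ m

/-!
Both parts say that a complex string passes an effective test of randomness of the following simple
kind: computable finite lists `D k` of strings of length `N k`, with at most `2 ^ (N k) / 4 ^ k`
entries each. Describing an entry of `D k` by its position in the list, after a self-delimiting
description of `k`, takes about `N k - k` bits, so the initial segments of a string in `KC` lie in
`D k` for finitely many `k` only (`initialSegment_notMem_of_computable`). No measure theory is
needed: the lists come from signed walks with finitely many integer steps, the steps being dyadic
approximations of the `u i` on a common scale, and the probabilities are counts of sign strings.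

For the first part, bounded partial sums for one complex string bound the terms `u i`, too. If
`∑ u i ^ 2` diverged, one could compute times `N k` at which the variance of the walk is so large
that, by Kolmogorov's second inequality (`flagCount_false_mul_le`), the walk stays within the given
bound for at most a fraction `4 ^ (-k)` of the sign strings. The complex string passes this test, so
its partial sums leave the bound, a contradiction.

For the second part, a computable value of `∑ u i ^ 2` makes the speed of convergence computable
(`exists_computable_tail_le`). The index set is then cut effectively into blocks `[n k, n (k + 1))`
of variance so small that, by Kolmogorov's maximal inequality (`flagCount_true_mul_sq_le`), the walk
oscillates by more than `2 ^ (-k)` on the `k`-th block for at most a fraction `4 ^ (-k)` of the sign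
strings. For a complex string, finitely many blocks excepted, the oscillations are thus summable,
and the partial sums form a Cauchy sequence.
-/

/-! ### Computability of integer and list operations -/

theorem Int.encode_natCast (n : ℕ) : Encodable.encode (n : ℤ) = 2 * n := rfl

theorem Int.encode_negSucc (n : ℕ) : Encodable.encode (Int.negSucc n) = 2 * n + 1 := rfl

theorem Primrec.int_toNat : Primrec Int.toNat := by
  refine (Primrec.cond (Primrec.nat_bodd.comp Primrec.encode) (Primrec.const 0)
    (Primrec.nat_div2.comp Primrec.encode)).of_eq fun z => ?_
  obtain ⟨n, rfl | rfl⟩ : ∃ n : ℕ, z = n ∨ z = Int.negSucc n := by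
    cases z with
    | ofNat n => exact ⟨n, Or.inl rfl⟩
    | negSucc n => exact ⟨n, Or.inr rfl⟩
  · simp [Int.encode_natCast, Nat.div2_val]
  · simp [Int.encode_negSucc]

theorem Primrec.int_neg_toNat : Primrec fun z : ℤ => (-z).toNat := by
  refine (Primrec.cond (Primrec.nat_bodd.comp Primrec.encode)
    (Primrec.succ.comp (Primrec.nat_div2.comp Primrec.encode)) (Primrec.const 0)).of_eq fun z => ?_
  obtain ⟨n, rfl | rfl⟩ : ∃ n : ℕ, z = n ∨ z = Int.negSucc n := by
    cases z with
    | ofNat n => exact ⟨n, Or.inl rfl⟩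
    | negSucc n => exact ⟨n, Or.inr rfl⟩
  · simp [Int.encode_natCast]
  · simp [Int.encode_negSucc, Nat.div2_val]

/-- Subtraction of natural numbers with values in `ℤ`. The other operations on `ℤ` are reduced to
it by means of positive and negative parts. -/
theorem Primrec.int_natCast_sub : Primrec₂ fun m n : ℕ => (m : ℤ) - n := by
  refine Primrec₂.encode_iff.1 ?_
  refine (Primrec.ite (Primrec.nat_le.comp Primrec.snd Primrec.fst)
    (Primrec.nat_double.comp (Primrec.nat_sub.comp Primrec.fst Primrec.snd))
    (Primrec.nat_double_succ.comp (Primrec.pred.comp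
      (Primrec.nat_sub.comp Primrec.snd Primrec.fst)))).of_eq fun p => ?_
  obtain ⟨m, n⟩ := p
  dsimp only
  split_ifs with h
  · obtain ⟨d, rfl⟩ := Nat.exists_eq_add_of_le h
    rw [show ((n + d : ℕ) : ℤ) - n = (d : ℕ) by push_cast; ring, Int.encode_natCast]
    simp
  · obtain ⟨d, rfl⟩ := Nat.exists_eq_add_of_lt (not_le.1 h)
    rw [show (m : ℤ) - ((m + d + 1 : ℕ) : ℤ) = Int.negSucc d by
      rw [Int.negSucc_eq]; push_cast; ring, Int.encode_negSucc]
    simp [add_assoc]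

theorem Primrec.int_natAbs : Primrec Int.natAbs :=
  (Primrec.nat_add.comp Primrec.int_toNat Primrec.int_neg_toNat).of_eq fun z => by omega

theorem Primrec.int_add : Primrec₂ ((· + ·) : ℤ → ℤ → ℤ) :=
  (Primrec.int_natCast_sub.comp
    (Primrec.nat_add.comp (Primrec.int_toNat.comp Primrec.fst)
      (Primrec.int_toNat.comp Primrec.snd))
    (Primrec.nat_add.comp (Primrec.int_neg_toNat.comp Primrec.fst)
      (Primrec.int_neg_toNat.comp Primrec.snd))).of_eq fun p => by
    obtain ⟨a, b⟩ := p
    simp only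
    omega

theorem Primrec.int_neg : Primrec ((- ·) : ℤ → ℤ) :=
  (Primrec.int_natCast_sub.comp Primrec.int_neg_toNat Primrec.int_toNat).of_eq fun z => by omega

theorem Primrec.nat_pow : Primrec₂ ((· ^ ·) : ℕ → ℕ → ℕ) :=
  Primrec₂.unpaired'.1 Nat.Primrec.pow

theorem Computable.tabulate {α β : Type*} [Primcodable α] [Primcodable β] {f : α → ℕ → β}
    {n : α → ℕ} (hf : Computable₂ f) (hn : Computable n) :
    Computable fun a => (List.range (n a)).map (f a) := by
  refine (Computable.nat_rec (g := fun _ => []) (h := fun a p => p.2 ++ [f a p.1]) hn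
    (Computable.const _) ?_).of_eq fun a => ?_
  · exact Computable.list_concat.comp (Computable.snd.comp Computable.snd)
      (hf.comp Computable.fst (Computable.fst.comp Computable.snd))
  · induction n a with
    | zero => rfl
    | succ m ih => simp only [List.range_succ, List.map_append, ← ih, List.map_cons, List.map_nil]

theorem Computable.sum_range {α : Type*} [Primcodable α] {f : α → ℕ → ℕ} {n : α → ℕ}
    (hf : Computable₂ f) (hn : Computable n) :
    Computable fun a => ∑ i ∈ Finset.range (n a), f a i := by
  refine (Computable.nat_rec (g := fun _ => 0) (h := fun a p => p.2 + f a p.1) hn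
    (Computable.const _) ?_).of_eq fun a => ?_
  · exact Primrec.nat_add.to_comp.comp (Computable.snd.comp Computable.snd)
      (hf.comp Computable.fst (Computable.fst.comp Computable.snd))
  · induction n a with
    | zero => rfl
    | succ m ih => simp only [Finset.sum_range_succ, ← ih]

/-- Unbounded search for a witness that always exists defines a computable function. -/
theorem Computable.exists_search {α : Type*} [Primcodable α] {p : α → ℕ → Bool}
    (hp : Computable₂ p) (h : ∀ a, ∃ n, p a n = true) :
    ∃ f : α → ℕ, Computable f ∧ ∀ a, p a (f a) = true := by
  refine ⟨fun a => Nat.find (h a), ?_, fun a => Nat.find_spec (h a)⟩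
  refine Partrec.of_eq_tot (f := fun a => Nat.rfind fun n => (p a n : Part Bool))
    (Partrec.rfind hp.partrec₂) fun a => ?_
  refine Nat.mem_rfind.2 ⟨by simpa using Nat.find_spec (h a), fun {m} hm => ?_⟩
  simpa using Nat.find_min (h a) hm

/-! ### Enumerating finite binary strings -/

/-- The list of all binary strings of length `n`. -/
def boolStrings : ℕ → List (List Bool)
  | 0 => [[]]
  | n + 1 => (boolStrings n).map (List.cons false) ++ (boolStrings n).map (List.cons true)

theorem primrec_boolStrings : Primrec boolStrings := by
  refine (Primrec.nat_rec₁ (f := fun _ (l : List (List Bool)) =>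
    l.map (List.cons false) ++ l.map (List.cons true)) [[]] ?_).of_eq fun n => ?_
  · exact Primrec.list_append.comp
      (Primrec.list_map Primrec.snd (Primrec.list_cons.comp (Primrec.const _) Primrec.snd).to₂)
      (Primrec.list_map Primrec.snd (Primrec.list_cons.comp (Primrec.const _) Primrec.snd).to₂)
  · induction n with
    | zero => rfl
    | succ n ih => simp only [boolStrings, ← ih]

theorem mem_boolStrings {n : ℕ} {s : List Bool} : s ∈ boolStrings n ↔ s.length = n := by
  induction n generalizing s with
  | zero => simp [boolStrings]
  | succ n ih =>
    cases s with
    | nil => simp [boolStrings]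
    | cons b s => cases b <;> simp [boolStrings, ih]

theorem length_boolStrings (n : ℕ) : (boolStrings n).length = 2 ^ n := by
  induction n with
  | zero => rfl
  | succ n ih => simp [boolStrings, ih, pow_succ, mul_two]

theorem countP_boolStrings_succ (n : ℕ) (p : List Bool → Bool) :
    (boolStrings (n + 1)).countP p =
      (boolStrings n).countP (fun s => p (false :: s)) +
        (boolStrings n).countP (fun s => p (true :: s)) := by
  simp [boolStrings, List.countP_append, List.countP_map, Function.comp_def]

/-! ### Signed partial sums and the two maximal inequalities of Kolmogorov -/

/-- `x` or `-x`, according to the sign coded by the bit. -/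
def signed (b : Bool) (x : ℤ) : ℤ := bif b then x else -x

/-- One step of the signed walk. The state is the current position, together with a flag recording
whether some position reached so far had absolute value larger than `c`. -/
def walkStep (c : ℕ) (q : ℤ × Bool) (x : ℤ) (b : Bool) : ℤ × Bool :=
  (q.1 + signed b x, q.2 || decide (c < (q.1 + signed b x).natAbs))

/-- The state after `n` steps of the walk with steps `± a i`, the signs being given by `s`. -/
def walk (c : ℕ) (a : ℕ → ℤ) (s : ℕ → Bool) (q : ℤ × Bool) (n : ℕ) : ℤ × Bool :=
  (List.range n).foldl (fun q i => walkStep c q (a i) (s i)) q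

theorem primrec_walkStep :
    Primrec fun p : (ℕ × (ℤ × Bool)) × (ℤ × Bool) => walkStep p.1.1 p.1.2 p.2.1 p.2.2 := by
  have h : Primrec fun p : (ℕ × (ℤ × Bool)) × (ℤ × Bool) => p.1.2.1 + signed p.2.2 p.2.1 :=
    Primrec.int_add.comp (Primrec.fst.comp (Primrec.snd.comp Primrec.fst))
      (Primrec.cond (Primrec.snd.comp Primrec.snd) (Primrec.fst.comp Primrec.snd)
        (Primrec.int_neg.comp (Primrec.fst.comp Primrec.snd)))
  exact Primrec.pair h (Primrec.or.comp (Primrec.snd.comp (Primrec.snd.comp Primrec.fst))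
    (Primrec.nat_lt.decide.comp (Primrec.fst.comp Primrec.fst) (Primrec.int_natAbs.comp h)))

/-- The walk is primitive recursive in the bound, the list of steps and the string of signs. Indices
beyond the end of a list read a default value, which is irrelevant to the walk. -/
theorem primrec_walk : Primrec fun p : (ℕ × List ℤ) × List Bool =>
    walk p.1.1 p.1.2.getI p.2.getI (0, false) p.1.2.length := by
  refine Primrec.list_foldl
    (f := fun p : (ℕ × List ℤ) × List Bool => List.range p.1.2.length)
    (g := fun _ => ((0 : ℤ), false))
    (h := fun p q => walkStep p.1.1 q.1 (p.1.2.getI q.2) (p.2.getI q.2))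
    (Primrec.list_range.comp (Primrec.list_length.comp (Primrec.snd.comp Primrec.fst)))
    (Primrec.const _) ?_
  refine primrec_walkStep.comp (Primrec.pair (Primrec.pair ?_ ?_) (Primrec.pair ?_ ?_))
  · exact Primrec.fst.comp (Primrec.fst.comp Primrec.fst)
  · exact Primrec.fst.comp Primrec.snd
  · exact Primrec.list_getI.comp (Primrec.snd.comp (Primrec.fst.comp Primrec.fst))
      (Primrec.snd.comp Primrec.snd)
  · exact Primrec.list_getI.comp (Primrec.snd.comp Primrec.fst) (Primrec.snd.comp Primrec.snd)

theorem walk_zero (c : ℕ) (a : ℕ → ℤ) (s : ℕ → Bool) (q : ℤ × Bool) : walk c a s q 0 = q := rfl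

theorem walk_succ (c : ℕ) (a : ℕ → ℤ) (s : ℕ → Bool) (q : ℤ × Bool) (n : ℕ) :
    walk c a s q (n + 1) = walkStep c (walk c a s q n) (a n) (s n) := by
  simp [walk, List.range_succ]

theorem walk_succ' (c : ℕ) (a : ℕ → ℤ) (s : ℕ → Bool) (q : ℤ × Bool) (n : ℕ) :
    walk c a s q (n + 1) =
      walk c (fun i => a (i + 1)) (fun i => s (i + 1)) (walkStep c q (a 0) (s 0)) n := by
  simp [walk, List.range_succ_eq_map, List.foldl_map]

theorem walk_congr {c : ℕ} {a a' : ℕ → ℤ} {s s' : ℕ → Bool} {q : ℤ × Bool} {n : ℕ}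
    (ha : ∀ i < n, a i = a' i) (hs : ∀ i < n, s i = s' i) : walk c a s q n = walk c a' s' q n := by
  induction n with
  | zero => rfl
  | succ n ih =>
    rw [walk_succ, walk_succ, ih (fun i hi => ha i (by omega)) (fun i hi => hs i (by omega)),
      ha n (by omega), hs n (by omega)]

theorem walk_fst (c : ℕ) (a : ℕ → ℤ) (s : ℕ → Bool) (n : ℕ) :
    (walk c a s (0, false) n).1 = ∑ i ∈ Finset.range n, signed (s i) (a i) := by
  induction n with
  | zero => rfl
  | succ n ih => rw [walk_succ, Finset.sum_range_succ, ← ih]; rfl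

theorem walk_snd_eq_true_iff (c : ℕ) (a : ℕ → ℤ) (s : ℕ → Bool) (n : ℕ) :
    (walk c a s (0, false) n).2 = true ↔
      ∃ j ≤ n, c < (∑ i ∈ Finset.range j, signed (s i) (a i)).natAbs := by
  induction n with
  | zero => simp [walk_zero]
  | succ n ih =>
    have h : (walk c a s (0, false) (n + 1)).2 = ((walk c a s (0, false) n).2 ||
        decide (c < (∑ i ∈ Finset.range (n + 1), signed (s i) (a i)).natAbs)) := by
      rw [← walk_fst c a s (n + 1), walk_succ]
      rfl
    rw [h, Bool.or_eq_true, ih, decide_eq_true_iff]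
    constructor
    · rintro (⟨j, hj, h⟩ | h)
      · exact ⟨j, by omega, h⟩
      · exact ⟨n + 1, le_rfl, h⟩
    · rintro ⟨j, hj, h⟩
      rcases Nat.lt_or_ge j (n + 1) with hj' | hj'
      · exact Or.inl ⟨j, by omega, h⟩
      · obtain rfl : j = n + 1 := by omega
        exact Or.inr h

theorem walk_snd_of_flag (c : ℕ) (a : ℕ → ℤ) (s : ℕ → Bool) (x : ℤ) (n : ℕ) :
    (walk c a s (x, true) n).2 = true := by
  induction n with
  | zero => rfl
  | succ n ih => rw [walk_succ, walkStep, ih]; rfl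

/-- The number of sign strings of length `n` after which the walk is in a state with flag `b`. -/
def flagCount (b : Bool) (c : ℕ) (a : ℕ → ℤ) (q : ℤ × Bool) (n : ℕ) : ℕ :=
  (boolStrings n).countP fun s => (walk c a s.getI q n).2 == b

theorem flagCount_succ (b : Bool) (c : ℕ) (a : ℕ → ℤ) (q : ℤ × Bool) (n : ℕ) :
    flagCount b c a q (n + 1) =
      flagCount b c (fun i => a (i + 1)) (walkStep c q (a 0) false) n +
        flagCount b c (fun i => a (i + 1)) (walkStep c q (a 0) true) n := by
  simp only [flagCount, countP_boolStrings_succ, walk_succ', List.getI_cons_succ,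
    List.getI_cons_zero]

theorem flagCount_true_le (c : ℕ) (a : ℕ → ℤ) (q : ℤ × Bool) (n : ℕ) :
    flagCount true c a q n ≤ 2 ^ n :=
  List.countP_le_length.trans_eq (length_boolStrings n)

theorem flagCount_false_of_flag (c : ℕ) (a : ℕ → ℤ) (x : ℤ) (n : ℕ) :
    flagCount false c a (x, true) n = 0 := by
  simp [flagCount, walk_snd_of_flag]

/-- Kolmogorov's maximal inequality for the signed walk started at `x`, in counting form. -/
theorem flagCount_true_mul_sq_le (c : ℕ) (a : ℕ → ℤ) (x : ℤ) (n : ℕ) :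
    (flagCount true c a (x, false) n : ℤ) * c ^ 2 ≤
      2 ^ n * (x ^ 2 + ∑ i ∈ Finset.range n, a i ^ 2) := by
  induction n generalizing a x with
  | zero => simpa [flagCount, boolStrings, walk_zero] using sq_nonneg x
  | succ n ih =>
    -- After one step the walk either has left `[-c, c]`, or is a shorter walk of the same kind.
    have key : ∀ y : ℤ, (flagCount true c (fun i => a (i + 1)) (y, decide (c < y.natAbs)) n : ℤ)
        * c ^ 2 ≤ 2 ^ n * (y ^ 2 + ∑ i ∈ Finset.range n, a (i + 1) ^ 2) := by
      intro y
      by_cases hy : c < y.natAbs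
      · have h1 : (c : ℤ) ^ 2 ≤ y ^ 2 := by
          rw [← Int.natAbs_sq y]
          gcongr
        have h2 : (0 : ℤ) ≤ ∑ i ∈ Finset.range n, a (i + 1) ^ 2 :=
          Finset.sum_nonneg fun i _ => sq_nonneg _
        calc _ ≤ (2 : ℤ) ^ n * c ^ 2 := by
              gcongr
              exact_mod_cast flagCount_true_le _ _ _ _
          _ ≤ _ := by
              gcongr
              linarith
      · rw [decide_eq_false hy]
        exact ih _ _
    rw [flagCount_succ]
    have h0 := key (x + signed false (a 0))
    have h1 := key (x + signed true (a 0))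
    rw [Finset.sum_range_succ']
    simp only [walkStep, Bool.false_or]
    push_cast
    simp only [signed, cond_false, cond_true] at h0 h1 ⊢
    rw [add_mul]
    refine (add_le_add h0 h1).trans_eq ?_
    ring

/-- Kolmogorov's second inequality for the signed walk started at `x`, in counting form: a walk
with steps bounded by `B` rarely stays in `[-c, c]` when its variance is large. -/
theorem flagCount_false_mul_le (c B : ℕ) (a : ℕ → ℤ) (n : ℕ) (ha : ∀ i < n, (a i).natAbs ≤ B)
    (x : ℤ) (hx : x.natAbs ≤ c) :
    (flagCount false c a (x, false) n : ℤ) * ∑ i ∈ Finset.range n, a i ^ 2 ≤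
      2 ^ n * ((c + B) ^ 2 - x ^ 2) := by
  induction n generalizing a x with
  | zero =>
    have : x ^ 2 ≤ ((c : ℤ) + B) ^ 2 := by
      rw [← Int.natAbs_sq x]
      gcongr
      exact_mod_cast hx.trans (Nat.le_add_right c B)
    simpa using this
  | succ n ih =>
    have key : ∀ y : ℤ, y.natAbs ≤ c + B →
        (flagCount false c (fun i => a (i + 1)) (y, decide (c < y.natAbs)) n : ℤ)
        * ∑ i ∈ Finset.range n, a (i + 1) ^ 2 ≤ 2 ^ n * ((c + B) ^ 2 - y ^ 2) := by
      intro y hyB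
      by_cases hy : c < y.natAbs
      · rw [decide_eq_true hy, flagCount_false_of_flag]
        have : y ^ 2 ≤ ((c : ℤ) + B) ^ 2 := by
          rw [← Int.natAbs_sq y]
          gcongr
          exact_mod_cast hyB
        simpa using this
      · rw [decide_eq_false hy]
        exact ih _ (fun i hi => ha _ (by omega)) _ (by omega)
    have ha0 := ha 0 (by omega)
    have h0 := key (x + signed false (a 0)) (by simp only [signed, cond_false]; omega)
    have h1 := key (x + signed true (a 0)) (by simp only [signed, cond_true]; omega)
    have h2 : ((flagCount false c a (x, false) (n + 1) : ℕ) : ℤ) * a 0 ^ 2 ≤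
        2 ^ (n + 1) * a 0 ^ 2 := by
      gcongr
      exact_mod_cast List.countP_le_length.trans_eq (length_boolStrings (n + 1))
    rw [Finset.sum_range_succ', mul_add]
    rw [flagCount_succ] at h2 ⊢
    simp only [walkStep, Bool.false_or] at h2 ⊢
    push_cast at h2 ⊢
    simp only [signed, cond_false, cond_true] at h0 h1 h2 ⊢
    rw [add_mul]
    refine (add_le_add (add_le_add h0 h1) h2).trans_eq ?_
    ring

/-! ### Effective tests passed by complex strings -/

/-- The number with binary digits `τ`, least significant digit first. -/
def bitsToNat (τ : List Bool) : ℕ := τ.foldr (fun b m => (bif b then 1 else 0) + 2 * m) 0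

theorem primrec_bitsToNat : Primrec bitsToNat := by
  refine Primrec.list_foldr (f := fun τ : List Bool => τ) (g := fun _ => 0)
    (h := fun _ p => (bif p.1 then 1 else 0) + 2 * p.2) Primrec.id (Primrec.const _) ?_
  exact Primrec.nat_add.comp
    (Primrec.cond (Primrec.fst.comp Primrec.snd) (Primrec.const _) (Primrec.const _))
    (Primrec.nat_double.comp (Primrec.snd.comp Primrec.snd))

theorem exists_bitsToNat_eq {l j : ℕ} (h : j < 2 ^ l) :
    ∃ τ : List Bool, τ.length = l ∧ bitsToNat τ = j := by
  induction l generalizing j with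
  | zero => exact ⟨[], rfl, by simp [bitsToNat]; omega⟩
  | succ l ih =>
    obtain ⟨τ, h1, h2⟩ := ih (j := j / 2) (by omega)
    refine ⟨decide (j % 2 = 1) :: τ, by simp [h1], ?_⟩
    have : bitsToNat (decide (j % 2 = 1) :: τ) =
      (bif decide (j % 2 = 1) then 1 else 0) + 2 * bitsToNat τ := rfl
    rw [this, h2]
    rcases Nat.mod_two_eq_zero_or_one j with hj | hj <;> simp [hj] <;> omega

/-- Reads `1 ⋯ 1 0 τ` with `k` leading ones, and outputs the entry with index `τ` of the `k`-th
list `D k`, provided that `τ` has length `N k - 2 * k`. -/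
def listMachine (D : ℕ → List (List Bool)) (N : ℕ → ℕ) (p : List Bool) : Option (List Bool) :=
  (UniversalMachine.parse p).bind fun x =>
    if x.2.length = N x.1 - 2 * x.1 then (D x.1)[bitsToNat x.2]? else none

/-- Two comparable programs in the domain start with the same number `k` of ones, and the length of
what follows is determined by `k`. -/
theorem isPrefixFreeMachine_listMachine {D : ℕ → List (List Bool)} {N : ℕ → ℕ}
    (hD : Computable D) (hN : Computable N) :
    IsPrefixFreeMachine fun p => (listMachine D N p : Part (List Bool)) := by
  refine ⟨Computable.ofOption ?_, fun p q hp hq h => ?_⟩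
  · refine Computable.option_bind UniversalMachine.primrec_parse.to_comp ?_
    have h1 : Computable fun y : List Bool × (ℕ × List Bool) =>
        decide (y.2.2.length = N y.2.1 - 2 * y.2.1) :=
      (Primrec.eq (α := ℕ)).decide.to_comp.comp
        (Computable.list_length.comp (Computable.snd.comp Computable.snd))
        (Primrec.nat_sub.to_comp.comp (hN.comp (Computable.fst.comp Computable.snd))
          (Primrec.nat_double.to_comp.comp (Computable.fst.comp Computable.snd)))
    have h2 : Computable fun y : List Bool × (ℕ × List Bool) =>
        (D y.2.1)[bitsToNat y.2.2]? :=
      Computable.list_getElem?.comp (hD.comp (Computable.fst.comp Computable.snd))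
        (primrec_bitsToNat.to_comp.comp (Computable.snd.comp Computable.snd))
    refine (Computable.cond h1 h2 (Computable.const none)).of_eq fun y => ?_
    by_cases h : y.2.2.length = N y.2.1 - 2 * y.2.1 <;> simp [h]
  · have key : ∀ p, (listMachine D N p : Part (List Bool)).Dom → ∃ k τ,
        p = List.replicate k true ++ false :: τ ∧ τ.length = N k - 2 * k := by
      intro p hp
      obtain ⟨σ, hσ⟩ := Part.dom_iff_mem.1 hp
      rw [Part.mem_coe, Option.mem_def] at hσ
      obtain ⟨⟨k, τ⟩, h1, h2⟩ := Option.bind_eq_some_iff.1 hσ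
      split_ifs at h2 with h3
      exact ⟨k, τ, UniversalMachine.parse_eq_some.1 h1, h3⟩
    obtain ⟨k, τ, rfl, h1⟩ := key p hp
    obtain ⟨l, ρ, rfl, h2⟩ := key q hq
    obtain ⟨t, ht⟩ := h
    have := (UniversalMachine.parse_eq_some (p := List.replicate l true ++ false :: ρ) (e := k)
      (τ := τ ++ t)).2 (by rw [← ht]; simp)
    rw [UniversalMachine.parse_eq_some.2 rfl] at this
    simp only [Option.some.injEq, Prod.mk.injEq] at this
    obtain ⟨rfl, rfl⟩ := this
    have : t = [] := by
      rw [List.length_append] at h2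
      exact List.length_eq_zero_iff.1 (by omega)
    simp [this]

/-- If `D k` has at most `2 ^ (N k - 2 * k)` entries, then they have descriptions by about
`N k - k` bits, so `D k` cannot contain initial segments of length `N k` of a complex string for
large `k`. -/
theorem initialSegment_notMem_of_computable {D : ℕ → List (List Bool)} {N : ℕ → ℕ}
    (hD : Computable D) (hN : Computable N) (hcard : ∀ k, (D k).length * 4 ^ k ≤ 2 ^ N k)
    {α : ℕ → Bool} (hα : α ∈ KC) : ∃ k₀, ∀ k ≥ k₀, initialSegment α (N k) ∉ D k := by
  obtain ⟨d, hd⟩ := hα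
  obtain ⟨c, hc⟩ := isUniversalMachine_referenceMachine.optimal _
    (isPrefixFreeMachine_listMachine hD hN)
  refine ⟨c + d + 2, fun k hk hmem => ?_⟩
  obtain ⟨j, hj, hjσ⟩ := List.mem_iff_getElem.1 hmem
  have h4 : (4 : ℕ) ^ k = 2 ^ (2 * k) := by rw [pow_mul]; norm_num
  have hle : 2 * k ≤ N k := by
    by_contra! hlt
    have h1 := hcard k
    have h2 : 2 ^ N k < 2 ^ (2 * k) := Nat.pow_lt_pow_right (by norm_num) hlt
    rw [h4] at h1
    have h3 : 1 * 2 ^ (2 * k) ≤ (D k).length * 2 ^ (2 * k) := Nat.mul_le_mul_right _ (by omega)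
    omega
  have hj' : j < 2 ^ (N k - 2 * k) := by
    refine hj.trans_le (Nat.le_of_mul_le_mul_right ?_ (Nat.pos_of_ne_zero (n := 4 ^ k) (by simp)))
    refine (hcard k).trans_eq ?_
    rw [h4, ← pow_add, Nat.sub_add_cancel hle]
  obtain ⟨τ, hτ, hτj⟩ := exists_bitsToNat_eq hj'
  have hout : initialSegment α (N k) ∈
      (listMachine D N (List.replicate k true ++ false :: τ) : Part (List Bool)) := by
    rw [Part.mem_coe, Option.mem_def, listMachine, UniversalMachine.parse_eq_some.2 rfl]
    simp [hτ, hτj, hjσ, hj]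
  have hM : machineComplexity (fun p => (listMachine D N p : Part (List Bool)))
      (initialSegment α (N k)) ≤ _ :=
    iInf₂_le (f := fun (τ : List Bool) _ => (τ.length : ℕ∞)) _ hout
  have hK := (hd (N k)).trans (add_le_add_left ((hc _).trans (add_le_add_left hM _)) _)
  simp only [List.length_append, List.length_replicate, List.length_cons, hτ] at hK
  norm_cast at hK
  omega

theorem getI_initialSegment (α : ℕ → Bool) {n i : ℕ} (hi : i < n) :
    (initialSegment α n).getI i = α i := by
  rw [List.getI_eq_getElem _ (by simpa [initialSegment] using hi)]
  simp [initialSegment]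

/-- The sign strings of length `n` after which the walk with steps from the list `l` and bound `c`
is in a state with flag `b`. -/
def flagStrings (b : Bool) (c : ℕ) (l : List ℤ) (n : ℕ) : List (List Bool) :=
  (boolStrings n).filter fun s => (walk c l.getI s.getI (0, false) l.length).2 == b

theorem primrec_flagStrings (b : Bool) :
    Primrec fun p : (ℕ × List ℤ) × ℕ => flagStrings b p.1.1 p.1.2 p.2 := by
  have h : Primrec fun p : (ℕ × List ℤ) × List Bool =>
      (walk p.1.1 p.1.2.getI p.2.getI (0, false) p.1.2.length).2 == b :=
    Primrec.beq.comp (Primrec.snd.comp primrec_walk) (Primrec.const b)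
  refine (Primrec.listFilterMap (f := fun p : (ℕ × List ℤ) × ℕ => boolStrings p.2)
    (g := fun p s => bif (walk p.1.1 p.1.2.getI s.getI (0, false) p.1.2.length).2 == b
      then some s else none)
    (primrec_boolStrings.comp Primrec.snd) ?_).of_eq fun p => ?_
  · exact Primrec.cond (h.comp (Primrec.pair (Primrec.fst.comp Primrec.fst) Primrec.snd))
      (Primrec.option_some.comp Primrec.snd) (Primrec.const none)
  · rw [flagStrings, ← List.filterMap_eq_filter]
    refine congrArg (fun g => List.filterMap g _) (funext fun s => ?_)
    simp only [Option.guard, cond_eq_ite]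

theorem flagStrings_map_range (b : Bool) (c : ℕ) (a : ℕ → ℤ) (n : ℕ) :
    flagStrings b c ((List.range n).map a) n =
      (boolStrings n).filter fun s => (walk c a s.getI (0, false) n).2 == b := by
  refine List.filter_congr fun s _ => ?_
  rw [List.length_map, List.length_range, walk_congr (a' := a) (s' := s.getI) _ fun _ _ => rfl]
  intro i hi
  rw [List.getI_eq_getElem _ (by simpa using hi)]
  simp

/-- The test lemma for signed walks: if the walks with integer steps `a k i` for `i < N k` are
uniformly computable, and the flag value `b` occurs with frequency at most `4⁻ᵏ`, then the signs
given by a complex string lead to this value for finitely many `k` only. -/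
theorem walk_snd_ne_of_mem_KC {a : ℕ → ℕ → ℤ} {N c : ℕ → ℕ} (b : Bool) (ha : Computable₂ a)
    (hN : Computable N) (hc : Computable c)
    (hcount : ∀ k, flagCount b (c k) (a k) (0, false) (N k) * 4 ^ k ≤ 2 ^ N k)
    {α : ℕ → Bool} (hα : α ∈ KC) :
    ∃ k₀, ∀ k ≥ k₀, (walk (c k) (a k) α (0, false) (N k)).2 ≠ b := by
  have hD : Computable fun k => flagStrings b (c k) ((List.range (N k)).map (a k)) (N k) :=
    Computable.comp (f := fun p : (ℕ × List ℤ) × ℕ => flagStrings b p.1.1 p.1.2 p.2)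
      (g := fun k => ((c k, (List.range (N k)).map (a k)), N k)) (primrec_flagStrings b).to_comp
      (Computable.pair (Computable.pair hc (Computable.tabulate ha hN)) hN)
  obtain ⟨k₀, hk₀⟩ := initialSegment_notMem_of_computable hD hN (fun k => by
    rw [flagStrings_map_range, ← List.countP_eq_length_filter]
    exact hcount k) hα
  refine ⟨k₀, fun k hk h => hk₀ k hk ?_⟩
  rw [flagStrings_map_range, List.mem_filter, mem_boolStrings]
  refine ⟨by simp [initialSegment], ?_⟩
  rw [walk_congr (a' := a k) (s' := α) (fun _ _ => rfl) fun i hi => getI_initialSegment α hi, h]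
  simp

/-! ### Real series and their integer approximations -/

theorem cast_signed (α : ℕ → Bool) (i : ℕ) (x : ℤ) :
    ((signed (α i) x : ℤ) : ℝ) = rademacher α i * x := by
  cases h : α i <;> simp [signed, rademacher, h]

theorem abs_rademacher (α : ℕ → Bool) (i : ℕ) : |rademacher α i| = 1 := by
  unfold rademacher
  split_ifs <;> simp

theorem abs_two_pow_mul_sub_le {u : ℕ → ℝ} {z : ℕ → ℕ → ℤ}
    (hz : ∀ n m : ℕ, |u n - (z n m : ℝ) / 2 ^ m| ≤ 1 / 2 ^ m) (n m : ℕ) :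
    |2 ^ m * u n - z n m| ≤ 1 := by
  have h : (2 : ℝ) ^ m * u n - z n m = 2 ^ m * (u n - (z n m : ℝ) / 2 ^ m) := by
    field_simp
  rw [h, abs_mul, abs_of_pos (by positivity : (0 : ℝ) < 2 ^ m)]
  calc (2 : ℝ) ^ m * |u n - (z n m : ℝ) / 2 ^ m| ≤ 2 ^ m * (1 / 2 ^ m) := by
        gcongr
        exact hz n m
    _ = 1 := by field_simp

theorem abs_sum_signed_sub_le {v : ℕ → ℝ} {a : ℕ → ℤ} (h : ∀ i, |v i - a i| ≤ 1) (α : ℕ → Bool)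
    (n : ℕ) : |∑ i ∈ Finset.range n, rademacher α i * v i -
      ((∑ i ∈ Finset.range n, signed (α i) (a i) : ℤ) : ℝ)| ≤ n := by
  push_cast
  rw [← Finset.sum_sub_distrib]
  refine (Finset.abs_sum_le_sum_abs _ _).trans ?_
  calc _ ≤ ∑ i ∈ Finset.range n, (1 : ℝ) := Finset.sum_le_sum fun i _ => by
        rw [cast_signed, ← mul_sub, abs_mul, abs_rademacher, one_mul]
        exact h i
    _ = n := by simp

theorem seriesConverges_iff_summable_of_nonneg {a : ℕ → ℝ} (ha : ∀ n, 0 ≤ a n) :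
    SeriesConverges a ↔ Summable a :=
  ⟨fun ⟨_, h⟩ => ((hasSum_iff_tendsto_nat_of_nonneg ha _).2 h).summable,
    fun h => ⟨_, h.hasSum.tendsto_sum_nat⟩⟩

/-! ### Convergence for one complex string implies square summability -/

/-- Bounded partial sums for a single complex string force `∑ uₙ²` to converge. -/
theorem seriesConverges_sq_of_mem_KC {u : ℕ → ℝ} (hu : IsComputableRealSeq u) {α : ℕ → Bool}
    (hα : α ∈ KC) (h : SeriesConverges fun n => rademacher α n * u n) :
    SeriesConverges fun n => u n ^ 2 := by
  obtain ⟨z, hzc, hz⟩ := hu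
  have hzu := abs_two_pow_mul_sub_le hz
  obtain ⟨s, hs⟩ := h
  obtain ⟨C, hC⟩ : ∃ C : ℕ, ∀ j, |∑ i ∈ Finset.range j, rademacher α i * u i| ≤ C := by
    obtain ⟨R, hR⟩ := (Metric.isBounded_range_of_tendsto _ hs).exists_norm_le
    obtain ⟨C, hC⟩ := exists_nat_ge R
    exact ⟨C, fun j => (hR _ ⟨j, rfl⟩).trans hC⟩
  have hB : ∀ i, |u i| ≤ 2 * C := by
    intro i
    have h1 := hC (i + 1)
    rw [Finset.sum_range_succ] at h1
    rw [← one_mul |u i|, ← abs_rademacher α i, ← abs_mul]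
    have h2 := hC i
    rw [abs_le] at h1 h2 ⊢
    constructor <;> linarith
  rw [seriesConverges_iff_summable_of_nonneg fun n => sq_nonneg _]
  by_contra hns
  have htop := (not_summable_iff_tendsto_nat_atTop_of_nonneg fun n => sq_nonneg (u n)).1 hns
  -- The walks are confined to `[-(C + 1), C + 1]`, their steps to `[-(2 * C + 1), 2 * C + 1]`, where
  -- the summand `1` makes room for the approximation errors; `E` is the sum of the two bounds.
  set E : ℕ := 3 * C + 2 with hE
  have hn4 : ∀ n : ℕ, (n : ℝ) ≤ 4 ^ n := fun n => by
    exact_mod_cast (Nat.lt_pow_self (by norm_num : 1 < 4)).le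
  -- Up to a time `N k`, the dyadic approximations of precision `2 ^ (-N k)` have a variance large
  -- enough for Kolmogorov's second inequality.
  obtain ⟨N, hNc, hN⟩ := Computable.exists_search
    (p := fun k N => decide (4 ^ k * (E * 2 ^ N) ^ 2 ≤
      ∑ i ∈ Finset.range N, (z i N).natAbs ^ 2))
    (by
      refine Primrec.nat_le.decide.to_comp.comp ?_ ?_
      · exact Primrec.nat_mul.to_comp.comp
          (Primrec.nat_pow.to_comp.comp (Computable.const 4) Computable.fst)
          (Primrec.nat_pow.to_comp.comp (Primrec.nat_mul.to_comp.comp (Computable.const E)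
            (Primrec.nat_pow.to_comp.comp (Computable.const 2) Computable.snd))
            (Computable.const 2))
      · refine Computable.sum_range (f := fun (p : ℕ × ℕ) i => (z i p.2).natAbs ^ 2) ?_
          Computable.snd
        exact Primrec.nat_pow.to_comp.comp (Primrec.int_natAbs.to_comp.comp
          (hzc.comp Computable.snd (Computable.snd.comp Computable.fst))) (Computable.const 2))
    (by
      intro k
      obtain ⟨N, hN⟩ := (htop.eventually_ge_atTop (2 * (4 ^ k * (E : ℝ) ^ 2 + 1))).exists
      refine ⟨N, ?_⟩
      rw [decide_eq_true_iff, ← Nat.cast_le (α := ℝ)]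
      push_cast
      have h1 : ∀ i, (2 ^ N * u i) ^ 2 ≤ 2 * ((z i N : ℤ) : ℝ) ^ 2 + 2 := by
        intro i
        have := hzu i N
        have h3 := sq_le_one_iff_abs_le_one (2 ^ N * u i - z i N) |>.2 this
        nlinarith [sq_nonneg (2 ^ N * u i - 2 * z i N)]
      have h2 : ∑ i ∈ Finset.range N, (2 ^ N * u i) ^ 2 ≤
          ∑ i ∈ Finset.range N, (2 * ((z i N : ℤ) : ℝ) ^ 2 + 2) :=
        Finset.sum_le_sum fun i _ => h1 i
      simp only [mul_pow, Finset.sum_add_distrib, ← Finset.mul_sum, Finset.sum_const,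
        Finset.card_range, nsmul_eq_mul] at h2
      have h4 : ((2 : ℝ) ^ N) ^ 2 = 4 ^ N := by rw [← pow_mul, mul_comm, pow_mul]; norm_num
      have h5 : ∀ i, ((((z i N).natAbs : ℕ) : ℝ)) ^ 2 = ((z i N : ℤ) : ℝ) ^ 2 := fun i => by
        rw [Nat.cast_natAbs, Int.cast_abs, sq_abs]
      simp only [h5, mul_pow, h4] at h2 ⊢
      have h6 : (4 : ℝ) ^ N * (2 * (4 ^ k * (E : ℝ) ^ 2 + 1)) ≤
          4 ^ N * ∑ i ∈ Finset.range N, u i ^ 2 := by gcongr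
      have h7 := hn4 N
      linarith)
  simp only [decide_eq_true_iff] at hN
  obtain ⟨k₀, hk₀⟩ := walk_snd_ne_of_mem_KC (a := fun k i => z i (N k)) (N := N)
    (c := fun k => (C + 1) * 2 ^ N k) false
    (hzc.comp Computable.snd (hNc.comp Computable.fst)) hNc
    (Primrec.nat_mul.to_comp.comp (Computable.const (C + 1))
      (Primrec.nat_pow.to_comp.comp (Computable.const 2) hNc))
    (by
      intro k
      have h1 : ∀ i < N k, (z i (N k)).natAbs ≤ (2 * C + 1) * 2 ^ N k := by
        intro i _
        rw [← Nat.cast_le (α := ℝ), Nat.cast_natAbs, Int.cast_abs]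
        push_cast
        have h2 := hzu i (N k)
        have h3 : |2 ^ N k * u i| ≤ 2 ^ N k * (2 * C) := by
          rw [abs_mul, abs_of_pos (by positivity : (0 : ℝ) < 2 ^ N k)]
          gcongr
          exact hB i
        have h4 : (1 : ℝ) ≤ 2 ^ N k := one_le_pow₀ (by norm_num)
        rw [abs_le] at h2 h3 ⊢
        constructor <;> linarith
      have h2 := flagCount_false_mul_le ((C + 1) * 2 ^ N k) ((2 * C + 1) * 2 ^ N k)
        (fun i => z i (N k)) (N k) h1 0 (by simp)
      set Q := flagCount false ((C + 1) * 2 ^ N k) (fun i => z i (N k)) (0, false) (N k)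
      have h3 : Q * ∑ i ∈ Finset.range (N k), (z i (N k)).natAbs ^ 2 ≤
          2 ^ N k * (E * 2 ^ N k) ^ 2 := by
        rw [← Nat.cast_le (α := ℤ)]
        push_cast at h2 ⊢
        simp only [sq_abs]
        refine h2.trans_eq ?_
        rw [hE]
        push_cast
        ring
      have h4 := (Nat.mul_le_mul_left Q (hN k)).trans h3
      rw [← mul_assoc] at h4
      exact Nat.le_of_mul_le_mul_right h4 (by positivity))
    hα
  refine hk₀ k₀ le_rfl ?_
  rw [← Bool.not_eq_true, walk_snd_eq_true_iff]
  rintro ⟨j, hj, hlt⟩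
  rw [← Nat.cast_lt (α := ℝ), Nat.cast_natAbs, Int.cast_abs] at hlt
  have h1 := abs_sum_signed_sub_le (fun i => hzu i (N k₀)) α j
  have h2 : |∑ i ∈ Finset.range j, rademacher α i * (2 ^ N k₀ * u i)| ≤ 2 ^ N k₀ * C := by
    simp only [mul_left_comm (rademacher α _), ← Finset.mul_sum]
    rw [abs_mul, abs_of_pos (by positivity : (0 : ℝ) < 2 ^ N k₀)]
    gcongr
    exact hC j
  have h3 : (j : ℝ) ≤ 2 ^ N k₀ := by
    exact_mod_cast hj.trans Nat.lt_two_pow_self.le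
  push_cast at hlt h1
  have h4 := abs_sub_abs_le_abs_sub (∑ i ∈ Finset.range j, ((signed (α i) (z i (N k₀)) : ℤ) : ℝ))
    (∑ i ∈ Finset.range j, rademacher α i * (2 ^ N k₀ * u i))
  rw [abs_sub_comm] at h4
  linarith

/-! ### A computable sum of squares implies convergence for all complex strings -/

/-- If `∑ uₙ²` has a computable sum, then the speed of its convergence is computable. -/
theorem exists_computable_tail_le {u : ℕ → ℝ} (hu : IsComputableRealSeq u) {s : ℝ}
    (hs : SeriesConvergesTo (fun n => u n ^ 2) s) (hsc : IsComputableReal s) :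
    ∃ n : ℕ → ℕ, Computable n ∧
      ∀ k, s - ∑ i ∈ Finset.range (n k), u i ^ 2 ≤ 1 / 2 ^ k := by
  obtain ⟨z, hzc, hz⟩ := hu
  obtain ⟨y, hyc, hy⟩ := hsc
  have hzu := abs_two_pow_mul_sub_le hz
  have hyu := abs_two_pow_mul_sub_le (u := fun _ => s) (z := fun _ => y) fun _ => hy
  have hle : ∀ n, ∑ i ∈ Finset.range n, u i ^ 2 ≤ s := fun n =>
    sum_le_hasSum _ (fun i _ => sq_nonneg _)
      ((hasSum_iff_tendsto_nat_of_nonneg (fun i => sq_nonneg _) _).2 hs)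
  have hs0 : 0 ≤ s := by simpa using hle 0
  -- This bound enters the algorithm as a constant.
  obtain ⟨B, hB⟩ : ∃ B : ℕ, ∀ i, |u i| ≤ B := by
    obtain ⟨B, hB⟩ := exists_nat_ge (s + 1)
    refine ⟨B, fun i => le_trans ?_ hB⟩
    have h1 := hle (i + 1)
    rw [Finset.sum_range_succ] at h1
    have h2 : 0 ≤ ∑ i ∈ Finset.range i, u i ^ 2 := Finset.sum_nonneg fun _ _ => sq_nonneg _
    nlinarith [sq_abs (u i), sq_nonneg (|u i| - 1)]
  -- As `0 ≤ s`, truncating the approximations of `s` at `0` does not increase their error.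
  let t : ℕ → ℕ := fun e => (y e).toNat
  have ht : ∀ e, |2 ^ e * s - t e| ≤ 1 := by
    intro e
    have h1 : ((t e : ℕ) : ℝ) = max (y e : ℝ) 0 := by
      rw [← Int.cast_natCast, Int.toNat_eq_max]
      push_cast
      rfl
    have h2 : (0 : ℝ) ≤ 2 ^ e * s := by positivity
    rw [h1, ← max_eq_left h2]
    exact (abs_max_sub_max_le_abs _ _ _).trans (hyu 0 e)
  -- The precision depends on the number of terms, so that the sum of the errors stays small.
  have herr : ∀ e n : ℕ, |(4 : ℝ) ^ (n + B + e) * ∑ i ∈ Finset.range n, u i ^ 2 -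
      ((∑ i ∈ Finset.range n, (z i (n + B + e)).natAbs ^ 2 : ℕ) : ℝ)| * 2 ^ e ≤
      2 * 4 ^ (n + B + e) := by
    intro e n
    set p := n + B + e with hp
    have h4 : (4 : ℝ) ^ p = 2 ^ p * 2 ^ p := by rw [← mul_pow]; norm_num
    have h1 : ∀ i, |(4 : ℝ) ^ p * u i ^ 2 - ((z i p).natAbs : ℝ) ^ 2| ≤ 2 ^ p * (2 * B + 1) := by
      intro i
      have h5 : (((z i p).natAbs : ℕ) : ℝ) ^ 2 = (z i p : ℝ) ^ 2 := by
        rw [Nat.cast_natAbs, Int.cast_abs, sq_abs]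
      have h6 : |2 ^ p * u i| ≤ 2 ^ p * B := by
        rw [abs_mul, abs_of_pos (by positivity : (0 : ℝ) < 2 ^ p)]
        gcongr
        exact hB i
      have h7 : (1 : ℝ) ≤ 2 ^ p := one_le_pow₀ (by norm_num)
      have h8 := hzu i p
      have h9 : |2 ^ p * u i + z i p| ≤ 2 ^ p * (2 * B + 1) := by
        rw [abs_le] at h6 h8 ⊢
        constructor <;> linarith
      rw [h5, h4, show (2 : ℝ) ^ p * 2 ^ p * u i ^ 2 - (z i p : ℝ) ^ 2 =
        (2 ^ p * u i - z i p) * (2 ^ p * u i + z i p) by ring, abs_mul]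
      calc _ ≤ 1 * (2 ^ p * (2 * (B : ℝ) + 1)) := by gcongr
        _ = _ := one_mul _
    have h2 : |(4 : ℝ) ^ p * ∑ i ∈ Finset.range n, u i ^ 2 -
        ((∑ i ∈ Finset.range n, (z i p).natAbs ^ 2 : ℕ) : ℝ)| ≤ n * (2 ^ p * (2 * B + 1)) := by
      push_cast
      rw [Finset.mul_sum, ← Finset.sum_sub_distrib]
      refine (Finset.abs_sum_le_sum_abs _ _).trans ((Finset.sum_le_sum fun i _ => h1 i).trans_eq ?_)
      simp
    have h3 : (n : ℝ) ≤ 2 ^ n := by exact_mod_cast Nat.lt_two_pow_self.le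
    have hB2 : (2 * B + 1 : ℝ) ≤ 2 * 2 ^ B := by
      have : (B : ℝ) + 1 ≤ 2 ^ B := by exact_mod_cast Nat.lt_two_pow_self
      linarith
    calc _ ≤ (n * (2 ^ p * (2 * B + 1)) : ℝ) * 2 ^ e := by gcongr
      _ ≤ (2 ^ n * (2 ^ p * (2 * 2 ^ B)) : ℝ) * 2 ^ e := by gcongr
      _ = 2 * 4 ^ p := by
        rw [h4]
        nth_rw 2 [hp]
        rw [pow_add, pow_add]
        ring
  obtain ⟨n, hnc, hn⟩ := Computable.exists_search
    (p := fun e n => decide (t e * 4 ^ (n + B + e) ≤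
      2 ^ e * (∑ i ∈ Finset.range n, (z i (n + B + e)).natAbs ^ 2) + 4 * 4 ^ (n + B + e)))
    (by
      have hp : Computable fun q : ℕ × ℕ => q.2 + B + q.1 :=
        Primrec.nat_add.to_comp.comp
          (Primrec.nat_add.to_comp.comp Computable.snd (Computable.const B)) Computable.fst
      have h4 : Computable fun q : ℕ × ℕ => 4 ^ (q.2 + B + q.1) :=
        Primrec.nat_pow.to_comp.comp (Computable.const 4) hp
      refine Primrec.nat_le.decide.to_comp.comp
        (Primrec.nat_mul.to_comp.comp
          (Primrec.int_toNat.to_comp.comp (hyc.comp Computable.fst)) h4)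
        (Primrec.nat_add.to_comp.comp (Primrec.nat_mul.to_comp.comp
          (Primrec.nat_pow.to_comp.comp (Computable.const 2) Computable.fst) ?_)
          (Primrec.nat_mul.to_comp.comp (Computable.const 4) h4))
      refine Computable.sum_range (f := fun (q : ℕ × ℕ) i => (z i (q.2 + B + q.1)).natAbs ^ 2) ?_
        Computable.snd
      exact Primrec.nat_pow.to_comp.comp (Primrec.int_natAbs.to_comp.comp
        (hzc.comp Computable.snd (hp.comp Computable.fst))) (Computable.const 2))
    (by
      intro e
      have hev : ∀ᶠ n in atTop, s - 1 / 2 ^ e < ∑ i ∈ Finset.range n, u i ^ 2 :=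
        hs.eventually_const_lt (by simp)
      obtain ⟨n, hn⟩ := hev.exists
      refine ⟨n, ?_⟩
      rw [decide_eq_true_iff, ← Nat.cast_le (α := ℝ), Nat.cast_add, Nat.cast_mul, Nat.cast_mul,
        Nat.cast_mul]
      have h1 := herr e n
      set Z : ℝ := ((∑ i ∈ Finset.range n, (z i (n + B + e)).natAbs ^ 2 : ℕ) : ℝ)
      set Q := ∑ i ∈ Finset.range n, u i ^ 2
      push_cast
      set W : ℝ := 4 ^ (n + B + e) with hW
      have hW0 : 0 < W := by positivity
      have h2 : (W * Q - Z) * 2 ^ e ≤ 2 * W :=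
        (mul_le_mul_of_nonneg_right (le_abs_self _) (by positivity)).trans h1
      have h3 : 2 ^ e * s ≤ 2 ^ e * Q + 1 := by
        have : (2 : ℝ) ^ e * (s - 1 / 2 ^ e) ≤ 2 ^ e * Q := by gcongr
        rw [mul_sub, mul_one_div_cancel (by positivity)] at this
        linarith
      have h4 := (abs_le.1 (ht e)).1
      have h5 : (t e : ℝ) * W ≤ (2 ^ e * Q + 2) * W := by
        gcongr
        linarith
      linarith)
  simp only [decide_eq_true_iff] at hn
  -- The search with parameter `e` ensures a tail of at most `7 / 2 ^ e`, hence the shift by `3`.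
  refine ⟨fun k => n (k + 3), hnc.comp (Primrec.nat_add.to_comp.comp Computable.id
    (Computable.const 3)), fun k => ?_⟩
  have h0 := hn (k + 3)
  have h1 := herr (k + 3) (n (k + 3))
  have h4 := (abs_le.1 (ht (k + 3))).2
  rw [← Nat.cast_le (α := ℝ), Nat.cast_add, Nat.cast_mul, Nat.cast_mul, Nat.cast_mul] at h0
  set e := k + 3 with he
  set m := n e
  set Z : ℝ := ((∑ i ∈ Finset.range m, (z i (m + B + e)).natAbs ^ 2 : ℕ) : ℝ)
  set Q := ∑ i ∈ Finset.range m, u i ^ 2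
  push_cast at h0
  set W : ℝ := 4 ^ (m + B + e) with hW
  have hW0 : 0 < W := by positivity
  have h2 : -(W * Q - Z) * 2 ^ e ≤ 2 * W :=
    (mul_le_mul_of_nonneg_right (neg_le_abs _) (by positivity)).trans h1
  have h3 : 2 ^ e * s * W ≤ (2 ^ e * Q + 7) * W := by
    have : 2 ^ e * s * W ≤ (t e + 1) * W := by
      gcongr
      linarith
    linarith
  have h5 := le_of_mul_le_mul_right h3 hW0
  rw [he, pow_add] at h5
  rw [le_div_iff₀ (by positivity)]
  linarith

/-- A strictly increasing computable modulus of convergence for `∑ uₙ²`. -/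
theorem exists_computable_strictMono_tail_le {u : ℕ → ℝ} (hu : IsComputableRealSeq u) {s : ℝ}
    (hs : SeriesConvergesTo (fun n => u n ^ 2) s) (hsc : IsComputableReal s) :
    ∃ n : ℕ → ℕ, Computable n ∧ StrictMono n ∧
      ∀ k, s - ∑ i ∈ Finset.range (n k), u i ^ 2 ≤ 1 / 2 ^ k := by
  obtain ⟨n, hnc, hn⟩ := exists_computable_tail_le hu hs hsc
  refine ⟨fun k => ∑ i ∈ Finset.range (k + 1), (n i + 1), ?_, ?_, fun k => ?_⟩
  · exact Computable.sum_range (f := fun _ i => n i + 1)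
      (Computable.succ.comp (hnc.comp Computable.snd)) Computable.succ
  · refine strictMono_nat_of_lt_succ fun k => ?_
    rw [Finset.sum_range_succ _ (k + 1)]
    omega
  · refine le_trans ?_ (hn k)
    gcongr
    dsimp only
    rw [Finset.sum_range_succ]
    omega

/-- A sequence whose oscillation on the successive blocks `[n k, n (k + 1)]` is eventually at most
`2 / 2 ^ k` is a Cauchy sequence. -/
theorem cauchySeq_of_block_oscillation {S : ℕ → ℝ} {n : ℕ → ℕ} (hn : StrictMono n) {k₀ : ℕ}
    (h : ∀ k ≥ k₀, ∀ j, n k ≤ j → j ≤ n (k + 1) → |S j - S (n k)| ≤ 2 / 2 ^ k) :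
    CauchySeq S := by
  have key : ∀ d, ∀ k ≥ k₀, ∀ j, n k ≤ j → j ≤ n (k + d) → |S j - S (n k)| ≤ 4 / 2 ^ k := by
    intro d
    induction d with
    | zero =>
      intro k _ j h1 h2
      obtain rfl : j = n k := le_antisymm h2 h1
      simp
      positivity
    | succ d ih =>
      intro k hk j h1 h2
      rcases le_total j (n (k + 1)) with hj | hj
      · refine (h k hk j h1 hj).trans ?_
        gcongr
        norm_num
      · have h3 := ih (k + 1) (by omega) j hj (by rwa [add_assoc, add_comm 1 d])
        have h4 := h k hk (n (k + 1)) (hn.monotone (by omega)) le_rfl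
        have h5 := abs_sub_le (S j) (S (n (k + 1))) (S (n k))
        have h6 : (4 : ℝ) / 2 ^ (k + 1) + 2 / 2 ^ k = 4 / 2 ^ k := by
          rw [pow_succ]
          field_simp
          norm_num
        linarith
  rw [Metric.cauchySeq_iff']
  intro ε hε
  obtain ⟨k₁, hk₁⟩ := exists_pow_lt_of_lt_one (show 0 < ε / 4 by positivity)
    (show (1 / 2 : ℝ) < 1 by norm_num)
  refine ⟨n (max k₀ k₁), fun j hj => ?_⟩
  have h1 := key j (max k₀ k₁) (le_max_left _ _) j hj ((Nat.le_add_left _ _).trans (hn.id_le _))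
  rw [Real.dist_eq]
  refine h1.trans_lt ?_
  have h2 : (1 / 2 : ℝ) ^ max k₀ k₁ ≤ (1 / 2) ^ k₁ :=
    pow_le_pow_of_le_one (by norm_num) (by norm_num) (le_max_right _ _)
  have h3 : (4 : ℝ) / 2 ^ max k₀ k₁ = 4 * (1 / 2) ^ max k₀ k₁ := by
    rw [one_div, inv_pow, div_eq_mul_inv]
  linarith

/-- A computable sum of squares yields an effective cutting into blocks on which the maximal
inequality applies; a complex string has large oscillation on finitely many of them only. -/
theorem seriesConverges_of_mem_KC_of_isComputableReal {u : ℕ → ℝ} (hu : IsComputableRealSeq u)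
    {s : ℝ} (hs : SeriesConvergesTo (fun n => u n ^ 2) s) (hsc : IsComputableReal s)
    {α : ℕ → Bool} (hα : α ∈ KC) : SeriesConverges fun n => rademacher α n * u n := by
  obtain ⟨m, hmc, hmono, hm⟩ := exists_computable_strictMono_tail_le hu hs hsc
  obtain ⟨z, hzc, hz⟩ := hu
  have hzu := abs_two_pow_mul_sub_le hz
  have hle : ∀ n, ∑ i ∈ Finset.range n, u i ^ 2 ≤ s := fun n =>
    sum_le_hasSum _ (fun i _ => sq_nonneg _)
      ((hasSum_iff_tendsto_nat_of_nonneg (fun i => sq_nonneg _) _).2 hs)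
  -- The tail beyond `n k` is at most `4 ^ (-2k - 1)`.
  set n : ℕ → ℕ := fun k => m (4 * k + 2) with hn_def
  have hnc : Computable n := hmc.comp (Primrec.nat_add.to_comp.comp
    (Primrec.nat_mul.to_comp.comp (Computable.const 4) Computable.id) (Computable.const 2))
  have hn : StrictMono n := fun a b hab => hmono (by omega)
  -- The `k`-th walk approximates the block `[n k, n (k + 1))` with this precision.
  set P : ℕ → ℕ := fun k => n (k + 1) + 2 * k + 1 with hP
  have hNc : Computable fun k => n (k + 1) := hnc.comp Computable.succ
  have hPc : Computable P := Computable.succ.comp (Primrec.nat_add.to_comp.comp hNc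
    (Primrec.nat_mul.to_comp.comp (Computable.const 2) Computable.id))
  set a : ℕ → ℕ → ℤ := fun k i => bif decide (i < n k) then 0 else z i (P k) with ha
  set v : ℕ → ℕ → ℝ := fun k i => if i < n k then 0 else 2 ^ P k * u i with hv
  have hav : ∀ k i, |v k i - a k i| ≤ 1 := by
    intro k i
    by_cases h : i < n k
    · simp [hv, ha, h]
    · simpa [hv, ha, h] using hzu i (P k)
  obtain ⟨k₀, hk₀⟩ := walk_snd_ne_of_mem_KC (a := a) (N := fun k => n (k + 1))
    (c := fun k => 2 ^ (n (k + 1) + k + 1)) true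
    (Computable.cond (Primrec.nat_lt.decide.to_comp.comp Computable.snd (hnc.comp Computable.fst))
      (Computable.const 0) (hzc.comp Computable.snd (hPc.comp Computable.fst))) hNc
    (Primrec.nat_pow.to_comp.comp (Computable.const 2) (Computable.succ.comp
      (Primrec.nat_add.to_comp.comp hNc Computable.id)))
    (by
      intro k
      have h1 := flagCount_true_mul_sq_le (2 ^ (n (k + 1) + k + 1)) (a k) 0 (n (k + 1))
      set F := flagCount true (2 ^ (n (k + 1) + k + 1)) (a k) (0, false) (n (k + 1))
      set N := n (k + 1) with hN
      have hvar : ∑ i ∈ Finset.range N, (a k i : ℝ) ^ 2 ≤ 4 ^ (N + 1) := by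
        have h2 : ∀ i, (a k i : ℝ) ^ 2 ≤ 2 * v k i ^ 2 + 2 := by
          intro i
          have h3 := sq_le_one_iff_abs_le_one (v k i - a k i) |>.2 (hav k i)
          nlinarith [sq_nonneg (2 * v k i - a k i)]
        have h4 : ∑ i ∈ Finset.range N, v k i ^ 2 =
            4 ^ P k * (∑ i ∈ Finset.range N, u i ^ 2 - ∑ i ∈ Finset.range (n k), u i ^ 2) := by
          have hkN : n k ≤ N := hn.monotone (by omega)
          rw [← Finset.sum_range_add_sum_Ico _ hkN, ← Finset.sum_range_add_sum_Ico _ hkN,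
            add_sub_cancel_left, Finset.mul_sum, Finset.sum_eq_zero, zero_add]
          · refine Finset.sum_congr rfl fun i hi => ?_
            have : ¬ i < n k := not_lt.2 (Finset.mem_Ico.1 hi).1
            simp only [hv, this, if_false, mul_pow]
            rw [← pow_mul, mul_comm (P k) 2, pow_mul]
            norm_num
          · intro i hi
            simp [hv, Finset.mem_range.1 hi]
        have h5 : ∑ i ∈ Finset.range N, v k i ^ 2 ≤ 4 ^ N := by
          rw [h4]
          calc _ ≤ (4 : ℝ) ^ P k * (1 / 2 ^ (4 * k + 2)) := by
                gcongr
                have := hle N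
                have := hm (4 * k + 2)
                linarith
            _ = 4 ^ N := by
                rw [show (2 : ℝ) ^ (4 * k + 2) = 4 ^ (2 * k + 1) by
                  rw [show 4 * k + 2 = 2 * (2 * k + 1) by ring, pow_mul]; norm_num,
                  show P k = N + (2 * k + 1) from rfl, pow_add]
                field_simp
        have h6 : (N : ℝ) ≤ 4 ^ N := by
          exact_mod_cast (Nat.lt_pow_self (by norm_num : 1 < 4)).le
        calc _ ≤ ∑ i ∈ Finset.range N, (2 * v k i ^ 2 + 2) := Finset.sum_le_sum fun i _ => h2 i
          _ = 2 * ∑ i ∈ Finset.range N, v k i ^ 2 + 2 * N := by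
            rw [Finset.sum_add_distrib, ← Finset.mul_sum]
            simp [mul_comm]
          _ ≤ 4 ^ (N + 1) := by
            rw [pow_succ]
            linarith
      have hvar' : ∑ i ∈ Finset.range N, a k i ^ 2 ≤ 4 ^ (N + 1) := by exact_mod_cast hvar
      have h7 : (F : ℤ) * 4 ^ k * 4 ^ (N + 1) ≤ 2 ^ N * 4 ^ (N + 1) := by
        calc (F : ℤ) * 4 ^ k * 4 ^ (N + 1) = F * ((2 ^ (N + k + 1) : ℕ) : ℤ) ^ 2 := by
              push_cast
              rw [← pow_mul, mul_comm _ 2, pow_mul]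
              norm_num
              ring
          _ ≤ _ := h1
          _ ≤ _ := by
              gcongr
              linarith
      exact_mod_cast le_of_mul_le_mul_right h7 (by positivity))
    hα
  refine cauchySeq_tendsto_of_complete (cauchySeq_of_block_oscillation hn (k₀ := k₀) ?_)
  intro k hk j hj1 hj2
  have h1 := hk₀ k hk
  rw [Ne, walk_snd_eq_true_iff] at h1
  push Not at h1
  have h2 := h1 j hj2
  rw [← Nat.cast_le (α := ℝ), Nat.cast_natAbs, Int.cast_abs] at h2
  have h3 := abs_sum_signed_sub_le (hav k) α j
  have h4 : ∑ i ∈ Finset.range j, rademacher α i * v k i =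
      2 ^ P k * (∑ i ∈ Finset.range j, rademacher α i * u i -
        ∑ i ∈ Finset.range (n k), rademacher α i * u i) := by
    rw [← Finset.sum_range_add_sum_Ico _ hj1, ← Finset.sum_range_add_sum_Ico _ hj1,
      add_sub_cancel_left, Finset.mul_sum, Finset.sum_eq_zero, zero_add]
    · refine Finset.sum_congr rfl fun i hi => ?_
      have : ¬ i < n k := not_lt.2 (Finset.mem_Ico.1 hi).1
      simp only [hv, this, if_false]
      ring
    · intro i hi
      simp [hv, Finset.mem_range.1 hi]
  have h5 : (j : ℝ) ≤ 2 ^ (n (k + 1) + k + 1) := by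
    have h6 : n (k + 1) ≤ 2 ^ (n (k + 1) + k + 1) :=
      Nat.lt_two_pow_self.le.trans (Nat.pow_le_pow_right (by norm_num) (by omega))
    exact_mod_cast hj2.trans h6
  rw [h4] at h3
  set D := ∑ i ∈ Finset.range j, rademacher α i * u i -
        ∑ i ∈ Finset.range (n k), rademacher α i * u i
  have h7 := abs_sub_abs_le_abs_sub (2 ^ P k * D)
    ((∑ i ∈ Finset.range j, signed (α i) (a k i) : ℤ) : ℝ)
  rw [abs_mul, abs_of_pos (by positivity : (0 : ℝ) < 2 ^ P k)] at h7
  have h8 : (2 : ℝ) ^ P k = 2 ^ (n (k + 1) + k + 1) * 2 ^ k := by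
    rw [← pow_add]
    congr 1
    simp only [hP]
    ring
  push_cast at h2
  push_cast at h3 h7
  have h9 : (2 : ℝ) ^ (n (k + 1) + k + 1) * (2 ^ k * |D|) ≤ 2 ^ (n (k + 1) + k + 1) * 2 := by
    rw [← mul_assoc, ← h8]
    linarith
  rw [le_div_iff₀ (by positivity), mul_comm]
  exact le_of_mul_le_mul_left h9 (by positivity)

theorem mainTheorem10 (u : ℕ → ℝ) (hu : IsComputableRealSeq u) :
    ((∃ α ∈ KC, SeriesConverges fun n => rademacher α n * u n) →
      SeriesConverges fun n => u n ^ 2) ∧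
    ((∃ α ∈ KC, ¬ SeriesConverges fun n => rademacher α n * u n) →
      (¬ SeriesConverges fun n => u n ^ 2) ∨
        ∃ s : ℝ, SeriesConvergesTo (fun n => u n ^ 2) s ∧ ¬ IsComputableReal s) := by
  refine ⟨fun ⟨α, hα, h⟩ => seriesConverges_sq_of_mem_KC hu hα h, fun ⟨α, hα, h⟩ => ?_⟩
  rw [or_iff_not_imp_left, not_not]
  rintro ⟨s, hs⟩
  exact ⟨s, hs, fun hsc => h (seriesConverges_of_mem_KC_of_isComputableReal hu hs hsc hα)⟩
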